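/- Let $p$ be an odd prime and let $\mathbb{Z}_p$ be the ring of $p$-adic integers. For $x\in\mathbb{Z}_p$ let $\langle x\rangle_p\in\{0,1,\dots,p-1\}$ be the least nonnegative residue of $x$ modulo $p$, and write $x=\langle x\rangle_p+pt$ with $t\in\mathbb{Z}_p$. Let $\binom{x}{k}=\frac{x(x-1)\cdots(x-k+1)}{k!}$ be the generalized binomial coefficient, $\left(\frac{\cdot}{p}\right)$ the Legendre symbol, $[a]$ the integral part of $a$, and $E_n(y)$ the Euler polynomials, defined by $\frac{2e^{yz}}{e^z+1}=\sum_{n\ge 0}E_n(y)\frac{z^n}{n!}$. Equivalently, $E_n(y)=\sum_{k=0}^n\binom nk\frac{E_k}{2^k}\left(y-\frac12\right)^{n-k}$, where the Euler numbers $E_k$ are given by $E_0=1$ and $\sum_{0\le k\le n,\ 2\mid n-k}\binom nk E_k=0$ for $n\ge1$. Then $$\sum_{k=0}^{p-1}\frac{\binom{x}{k}\binom{x+k}{k}(-2)^k}{\binom{2k}{k}}\equiv(-1)^{\left[\frac{\langle x\rangle_p+1}{2}\right]}\left(1+t-(-1)^{\langle x\rangle_p}\left(\frac{-1}{p}\right)t\right)-\frac{pt(t+1)}{2}\left(E_{p-2}\left(\frac{x+1}{2}\right)+E_{p-2}\left(-\frac{x}{2}\right)\right)\pmod{p^2},$$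 that is, the difference of the two sides, taken in $\mathbb{Q}_p$, lies in $p^2\mathbb{Z}_p$. -/

import Mathlib

open Polynomial

/-- The Euler numbers `E_n`, determined by `E_0 = 1` and, for `n ≥ 1`,
`∑_{0 ≤ k ≤ n, 2 ∣ n - k} (n choose k) E_k = 0` (solved for its `k = n` term `E_n`). -/
def eulerNumber : ℕ → ℤ
  | 0 => 1
  | n + 1 => -∑ k : Fin (n + 1),
      if 2 ∣ n + 1 - (k : ℕ) then ((n + 1).choose k : ℤ) * eulerNumber k else 0
  decreasing_by exact k.isLt

/-- The Euler polynomial `E_n(X) = ∑_{k=0}^n (n choose k) (E_k / 2^k) (X - 1/2)^(n-k)`, i.e. the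
polynomials with generating function `2 e^{Xz} / (e^z + 1) = ∑ E_n(X) z^n / n!`. -/
noncomputable def eulerPolynomial (n : ℕ) : ℚ[X] :=
  ∑ k ∈ Finset.range (n + 1),
    C ((n.choose k : ℚ) * ((eulerNumber k : ℚ) / 2 ^ k)) * (X - C (1 / 2)) ^ (n - k)

/-- Congruence of two `p`-adic numbers modulo `p ^ m`: their difference lies in `p ^ m ℤ_p`. -/
def PadicModEq (p : ℕ) [Fact p.Prime] (m : ℕ) (a b : ℚ_[p]) : Prop :=
  ∃ z : ℤ_[p], a - b = (p : ℚ_[p]) ^ m * (z : ℚ_[p])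

/-! Since C(x,k) C(x+k,k) = C(2k,k) C(x+k,2k), the sum is S(x) = ∑_{k<p} (-2)^k C(x+k,2k), i.e.
`chooseSum p`. For k < p the denominators (2k)! contain p at most once, so pS has coefficients in
ℤ_p. Newton interpolation of pS at n-p, n, n+p with n = ⟨x⟩_p then gives S(n+pt) modulo p²
(`prime_sq_dvd_chooseSum_interpolation_error`).

S(x+2) + S(x) telescopes to one binomial coefficient, which vanishes where needed, so S(n) and
S(n-p) are exact signs; they give the main term. The second difference of S at n and
-p(E_{p-2}((n+1)/2) + E_{p-2}(-n/2)) satisfy the same two-step recurrence modulo p² and agree at n =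
0, 1 (`prime_sq_dvd_chooseSumDiff_add_eulerPair`). -/

/-! ### Euler numbers and Euler polynomials over a commutative ring -/

theorem sum_choose_mul_eulerNumber {m : ℕ} (hm : m ≠ 0) :
    ∑ k ∈ Finset.range (m + 1), (if 2 ∣ m - k then (m.choose k : ℤ) * eulerNumber k else 0) = 0 := by
  obtain ⟨m, rfl⟩ := Nat.exists_eq_succ_of_ne_zero hm
  rw [Finset.sum_range_succ]
  simp only [Nat.succ_eq_add_one, Nat.sub_self, dvd_zero, if_true, Nat.choose_self, Nat.cast_one,
    one_mul]
  rw [eulerNumber, Finset.sum_range]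
  ring

theorem eulerNumber_of_odd {n : ℕ} (hn : Odd n) : eulerNumber n = 0 := by
  induction n using Nat.strong_induction_on with
  | _ n ih =>
    have h := sum_choose_mul_eulerNumber hn.pos.ne'
    rw [Finset.sum_range_succ, Finset.sum_eq_zero] at h
    · simpa using h
    · intro k hk
      rw [Finset.mem_range] at hk
      split_ifs with h2
      · rw [ih k hk (by obtain ⟨a, rfl⟩ := hn; obtain ⟨b, hb⟩ := h2; exact ⟨a - b, by omega⟩),
          mul_zero]
      · rfl

section Ring

variable {R : Type*} [CommRing R]

/-- The value at `y` of the `n`-th Euler polynomial in a ring in which `h` plays the role of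
`1 / 2`. -/
def eulerEval (h : R) (n : ℕ) (y : R) : R :=
  ∑ k ∈ Finset.range (n + 1), (n.choose k : R) * ((eulerNumber k : R) * h ^ k) * (y - h) ^ (n - k)

/-- The linear functional `X ^ k ↦ E_k h ^ k`. -/
noncomputable def eulerFunctional (h : R) : R[X] →ₗ[R] R :=
  Polynomial.lsum fun k => LinearMap.mulRight R ((eulerNumber k : R) * h ^ k)

theorem eulerFunctional_C_mul_X_pow (h a : R) (k : ℕ) :
    eulerFunctional h (C a * X ^ k) = a * ((eulerNumber k : R) * h ^ k) := by
  simp [eulerFunctional, Polynomial.lsum_apply, C_mul_X_pow_eq_monomial, sum_monomial_index,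
    mul_assoc]

theorem eulerFunctional_X_add_C_pow (h a : R) (n : ℕ) :
    eulerFunctional h ((X + C a) ^ n) =
      ∑ k ∈ Finset.range (n + 1), (n.choose k : R) * ((eulerNumber k : R) * h ^ k) * a ^ (n - k) := by
  rw [add_pow, map_sum]
  refine Finset.sum_congr rfl fun k _ => ?_
  have : (X ^ k * C a ^ (n - k) * (n.choose k : R[X])) =
      C ((n.choose k : R) * a ^ (n - k)) * X ^ k := by
    simp only [map_mul, map_pow, map_natCast]; ring
  rw [this, eulerFunctional_C_mul_X_pow]
  ring

theorem eulerEval_eq_eulerFunctional (h : R) (n : ℕ) (y : R) :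
    eulerEval h n y = eulerFunctional h ((X + C (y - h)) ^ n) :=
  (eulerFunctional_X_add_C_pow h _ n).symm

/-- Umbral form of the Euler number recursion: on a monomial, terms with m - k odd cancel and the
others double. -/
theorem eulerFunctional_comp_add_comp (h : R) (q : R[X]) :
    eulerFunctional h (q.comp (X + C h) + q.comp (X + C (-h))) = 2 * q.eval 0 := by
  induction q using Polynomial.induction_on' with
  | add p q hp hq =>
    rw [add_comp, add_comp, eval_add, mul_add, ← hp, ← hq, ← map_add]
    congr 1
    ring
  | monomial m a =>
    simp only [monomial_comp, eval_monomial]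
    rw [← mul_add, ← smul_eq_C_mul, map_smul, map_add, eulerFunctional_X_add_C_pow,
      eulerFunctional_X_add_C_pow, ← Finset.sum_add_distrib]
    have key : ∀ k ∈ Finset.range (m + 1),
        (m.choose k : R) * ((eulerNumber k : R) * h ^ k) * h ^ (m - k) +
          (m.choose k : R) * ((eulerNumber k : R) * h ^ k) * (-h) ^ (m - k) =
        2 * h ^ m * ((if 2 ∣ m - k then (m.choose k : ℤ) * eulerNumber k else 0 : ℤ) : R) := by
      intro k hk
      have hkm : k ≤ m := Nat.lt_succ_iff.mp (Finset.mem_range.mp hk)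
      have hpow : h ^ m = h ^ k * h ^ (m - k) := by rw [← pow_add, Nat.add_sub_cancel' hkm]
      split_ifs with h2
      · rw [(even_iff_two_dvd.mpr h2).neg_pow, hpow]
        push_cast
        ring
      · rw [(Nat.not_even_iff_odd.mp (mt even_iff_two_dvd.mp h2)).neg_pow]
        push_cast
        ring
    rw [Finset.sum_congr rfl key, ← Finset.mul_sum, ← Int.cast_sum]
    rcases eq_or_ne m 0 with rfl | hm
    · simp [eulerNumber, mul_comm]
    · simp [sum_choose_mul_eulerNumber hm, hm]

theorem eulerEval_add_one_add {h : R} (hh : 2 * h = 1) (n : ℕ) (y : R) :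
    eulerEval h n (y + 1) + eulerEval h n y = 2 * y ^ n := by
  have key := eulerFunctional_comp_add_comp h ((X + C y) ^ n)
  simp only [pow_comp, add_comp, X_comp, C_comp, eval_pow, eval_add, eval_X, eval_C, zero_add,
    map_add] at key
  rw [← key, eulerEval_eq_eulerFunctional, eulerEval_eq_eulerFunctional]
  congr 3
  · rw [show y + 1 - h = h + y by linear_combination -hh, C_add]; ring
  · rw [sub_eq_neg_add, C_add]; ring

theorem eulerEval_self_of_odd (h : R) {n : ℕ} (hn : Odd n) : eulerEval h n h = 0 := by
  rw [eulerEval, Finset.sum_range_succ, Finset.sum_eq_zero]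
  · simp [eulerNumber_of_odd hn]
  · intro k hk
    rw [Finset.mem_range] at hk
    simp [Nat.sub_ne_zero_of_lt hk]

/-- Keeping h as a ring element lets values in ℤ_p be both reduced to `ZMod p` and sent to ℚ_p. -/
theorem map_eulerEval {S : Type*} [CommRing S] (f : R →+* S) (h : R) (n : ℕ) (y : R) :
    f (eulerEval h n y) = eulerEval (f h) n (f y) := by
  simp [eulerEval]

theorem aeval_eulerPolynomial {K : Type*} [Field K] [CharZero K] [Algebra ℚ K] (n : ℕ) (y : K) :
    aeval y (eulerPolynomial n) = eulerEval (1 / 2) n y := by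
  simp only [eulerPolynomial, eulerEval, map_sum, map_mul, map_pow, map_sub, aeval_X, aeval_C,
    map_natCast, map_div₀, map_intCast, map_one, map_ofNat]
  refine Finset.sum_congr rfl fun k _ => ?_
  rw [one_div, inv_pow, div_eq_mul_inv]

theorem sum_neg_one_pow_mul_pow {h : R} (hh : 2 * h = 1) (n m : ℕ) :
    2 * ∑ j ∈ Finset.range m, (-1) ^ j * (j : R) ^ n =
      eulerEval h n 0 - (-1) ^ m * eulerEval h n m := by
  induction m with
  | zero => simp
  | succ m ih =>
    rw [Finset.sum_range_succ, mul_add, ih, pow_succ, Nat.cast_succ]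
    linear_combination (-1) ^ m * (-1 : R) * eulerEval_add_one_add hh n (m : R)

/-- The combination `E_n((x + 1) / 2) + E_n(-x / 2)`. -/
def eulerPair (h : R) (n : ℕ) (x : R) : R :=
  eulerEval h n ((x + 1) * h) + eulerEval h n (-x * h)

theorem eulerPair_add_two_add {h : R} (hh : 2 * h = 1) (n : ℕ) (x : R) :
    eulerPair h n (x + 2) + eulerPair h n x =
      2 * ((x + 1) * h) ^ n + 2 * (-(x + 2) * h) ^ n := by
  rw [← eulerEval_add_one_add hh, ← eulerEval_add_one_add hh, eulerPair, eulerPair,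
    show (x + 2 + 1) * h = (x + 1) * h + 1 by linear_combination hh,
    show -x * h = -(x + 2) * h + 1 by linear_combination hh]
  ring

theorem eulerPair_zero (h : R) {n : ℕ} (hn : Odd n) :
    eulerPair h n 0 = eulerEval h n 0 := by
  simp [eulerPair, eulerEval_self_of_odd h hn]

theorem eulerPair_one {h : R} (hh : 2 * h = 1) {n : ℕ} (hn : Odd n) :
    eulerPair h n 1 = -eulerEval h n 0 - 2 * h ^ n := by
  have h1 := eulerEval_add_one_add hh n 0
  have h2 := eulerEval_add_one_add hh n (-1 * h)
  rw [show -1 * h + 1 = h by linear_combination -hh, eulerEval_self_of_odd h hn, neg_one_mul,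
    hn.neg_pow] at h2
  rw [zero_pow hn.pos.ne', zero_add] at h1
  rw [eulerPair, show (1 + 1) * h = 1 by linear_combination hh, neg_one_mul]
  linear_combination h1 + h2

theorem map_eulerPair {S : Type*} [CommRing S] (f : R →+* S) (h : R) (n : ℕ) (x : R) :
    f (eulerPair h n x) = eulerPair (f h) n (f x) := by
  simp [eulerPair, map_eulerEval]

end Ring

/-! ### Exact values and recurrences of the binomial sum -/

section Binomial

variable {R : Type*} [CommRing R] [BinomialRing R]

/-- The sum `∑_{k < N} (-2) ^ k (x + k choose 2 k)`. -/
noncomputable def chooseSum (N : ℕ) (x : R) : R :=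
  ∑ k ∈ Finset.range N, (-2) ^ k * Ring.choose (x + (k : R)) (2 * k)

theorem choose_second_difference (y : R) (j : ℕ) :
    Ring.choose (y + 2) (j + 2) - 2 * Ring.choose (y + 1) (j + 2) + Ring.choose y (j + 2) =
      Ring.choose y j := by
  have h1 := Ring.choose_succ_succ (y + 1) (j + 1)
  have h2 := Ring.choose_succ_succ y (j + 1)
  have h3 := Ring.choose_succ_succ y j
  rw [add_assoc, one_add_one_eq_two] at h1
  linear_combination h1 - h2 + h3

/-- The weight -2 matches the middle coefficient of the second difference of C(·,2k), so the sum
telescopes. -/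
theorem chooseSum_add_two_add (N : ℕ) (x : R) :
    chooseSum (N + 1) (x + 2) + chooseSum (N + 1) x =
      2 * (-2) ^ N * Ring.choose (x + (N : R) + 1) (2 * N) := by
  induction N with
  | zero => simp [chooseSum]; norm_num
  | succ N ih =>
    have h := choose_second_difference (x + (N : R) + 1) (2 * N)
    have hs : ∀ z : R, chooseSum (N + 1 + 1) z = chooseSum (N + 1) z +
        (-2) ^ (N + 1) * Ring.choose (z + ((N + 1 : ℕ) : R)) (2 * (N + 1)) :=
      fun z => Finset.sum_range_succ _ _
    rw [hs, hs, mul_add 2 N 1, mul_one]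
    push_cast
    rw [show x + 2 + ((N : R) + 1) = x + N + 1 + 2 by ring,
      show x + ((N : R) + 1) = x + N + 1 by ring]
    linear_combination ih + (-2) ^ (N + 1) * h

theorem chooseSum_zero (N : ℕ) : chooseSum (N + 1) (0 : R) = 1 := by
  rw [chooseSum, Finset.sum_range_succ', Finset.sum_eq_zero]
  · simp
  · intro k _
    rw [zero_add, Ring.choose_natCast, Nat.choose_eq_zero_of_lt (by omega)]
    simp

theorem chooseSum_neg_one (N : ℕ) : chooseSum (N + 1) (-1 : R) = 1 := by
  rw [chooseSum, Finset.sum_range_succ', Finset.sum_eq_zero]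
  · simp
  · intro k _
    rw [Nat.cast_succ, neg_add_cancel_comm_assoc, Ring.choose_natCast,
      Nat.choose_eq_zero_of_lt (by omega)]
    simp

theorem chooseSum_natCast_sub_add_two (m j : ℕ) :
    chooseSum (2 * m + 1) (((j + 2 : ℕ) : R) - ((2 * m + 1 : ℕ) : R)) =
      -chooseSum (2 * m + 1) ((j : R) - ((2 * m + 1 : ℕ) : R)) +
        2 ^ (2 * m + 1) * (j.choose (4 * m) : R) := by
  have h := chooseSum_add_two_add (2 * m) ((j : R) - ((2 * m + 1 : ℕ) : R))
  have hx : (j : R) - ((2 * m + 1 : ℕ) : R) + ((2 * m : ℕ) : R) + 1 = (j : R) := by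
    push_cast; ring
  rw [hx, Ring.choose_natCast, (even_two_mul m).neg_pow, show 2 * (2 * m) = 4 * m by ring] at h
  rw [show ((j + 2 : ℕ) : R) - ((2 * m + 1 : ℕ) : R) = (j : R) - ((2 * m + 1 : ℕ) : R) + 2 by
    push_cast; ring]
  linear_combination h

theorem chooseSum_natCast_sub_of_lt (m : ℕ) {n : ℕ} (hn : n < 4 * m + 2) :
    chooseSum (2 * m + 1) ((n : R) - ((2 * m + 1 : ℕ) : R)) = (-1) ^ (n / 2 + m) := by
  have step : ∀ b i : ℕ, 2 * i + b < 4 * m + 2 →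
      chooseSum (2 * m + 1) (((2 * i + b : ℕ) : R) - ((2 * m + 1 : ℕ) : R)) =
        (-1) ^ i * chooseSum (2 * m + 1) ((b : R) - ((2 * m + 1 : ℕ) : R)) := by
    intro b i
    induction i with
    | zero => simp
    | succ i ih =>
      intro h
      rw [show 2 * (i + 1) + b = (2 * i + b) + 2 by ring, chooseSum_natCast_sub_add_two,
        Nat.choose_eq_zero_of_lt (by omega), ih (by omega), pow_succ, Nat.cast_zero]
      ring
  have hsq : ((-1 : R) ^ m) * (-1) ^ m = 1 := by rw [← mul_pow]; simp
  -- The arguments 2m + b - (2m+1) are -1 and 0, where the sum is 1; the sign rule is run back from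
  -- there.
  have base : ∀ b : ℕ, b < 2 →
      chooseSum (2 * m + 1) ((b : R) - ((2 * m + 1 : ℕ) : R)) = (-1) ^ m := by
    intro b hb
    have h := step b m (by omega)
    have h1 : chooseSum (2 * m + 1) (((2 * m + b : ℕ) : R) - ((2 * m + 1 : ℕ) : R)) = 1 := by
      interval_cases b
      · rw [← chooseSum_neg_one (2 * m)]
        congr 1
        push_cast; ring
      · rw [sub_self, chooseSum_zero]
    rw [h1] at h
    linear_combination (-(-1) ^ m) * h -
      chooseSum (2 * m + 1) ((b : R) - ((2 * m + 1 : ℕ) : R)) * hsq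
  have h := step (n % 2) (n / 2) (by omega)
  rw [Nat.div_add_mod, base _ (Nat.mod_lt _ two_pos)] at h
  rw [h, pow_add]

theorem chooseSum_natCast (m : ℕ) {n : ℕ} (hn : n < 2 * m + 1) :
    chooseSum (2 * m + 1) (n : R) = (-1) ^ ((n + 1) / 2) := by
  have h := chooseSum_natCast_sub_of_lt (R := R) m (n := n + (2 * m + 1)) (by omega)
  rw [Nat.cast_add, add_sub_cancel_right] at h
  rw [h, show (n + (2 * m + 1)) / 2 + m = (n + 1) / 2 + 2 * m by omega, pow_add]
  simp

theorem chooseSum_natCast_sub (m : ℕ) {n : ℕ} (hn : n < 2 * m + 1) :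
    chooseSum (2 * m + 1) ((n : R) - ((2 * m + 1 : ℕ) : R)) =
      (-1) ^ ((n + 1) / 2) * ((-1) ^ n * (-1) ^ m) := by
  rw [chooseSum_natCast_sub_of_lt m (by omega), ← pow_add, ← pow_add]
  rcases Nat.even_or_odd' n with ⟨i, rfl | rfl⟩
  · rw [show (2 * i + 1) / 2 + (2 * i + m) = (2 * i / 2 + m) + 2 * i by omega, pow_add _ _ (2 * i)]
    simp
  · rw [show (2 * i + 1 + 1) / 2 + (2 * i + 1 + m) = ((2 * i + 1) / 2 + m) + 2 * (i + 1) by omega,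
      pow_add _ _ (2 * (i + 1))]
    simp

/-- The second difference of `chooseSum N` with step `N`. -/
noncomputable def chooseSumDiff (N : ℕ) (x : R) : R :=
  chooseSum N (x + (N : R)) - 2 * chooseSum N x + chooseSum N (x - (N : R))

theorem chooseSumDiff_natCast (m n : ℕ) :
    chooseSumDiff (2 * m + 1) (n : R) =
      chooseSum (2 * m + 1) (((n + (4 * m + 2) : ℕ) : R) - ((2 * m + 1 : ℕ) : R))
        - 2 * chooseSum (2 * m + 1) (((n + (2 * m + 1) : ℕ) : R) - ((2 * m + 1 : ℕ) : R))
        + chooseSum (2 * m + 1) ((n : R) - ((2 * m + 1 : ℕ) : R)) := by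
  rw [chooseSumDiff,
    show ((n + (4 * m + 2) : ℕ) : R) - ((2 * m + 1 : ℕ) : R) = n + ((2 * m + 1 : ℕ) : R) by
      push_cast; ring, Nat.cast_add n (2 * m + 1), add_sub_cancel_right]

theorem chooseSumDiff_zero (m : ℕ) :
    chooseSumDiff (2 * m + 1) (0 : R) = 2 ^ (2 * m + 1) - 2 := by
  have h := chooseSumDiff_natCast (R := R) m 0
  rw [show 0 + (4 * m + 2) = 4 * m + 2 by ring, chooseSum_natCast_sub_add_two,
    chooseSum_natCast_sub_of_lt m (n := 4 * m) (by omega),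
    chooseSum_natCast_sub_of_lt m (n := 0 + (2 * m + 1)) (by omega),
    chooseSum_natCast_sub_of_lt m (n := 0) (by omega), Nat.choose_self,
    show 4 * m / 2 + m = 2 * m + m by omega, show (0 + (2 * m + 1)) / 2 + m = 2 * m by omega,
    show 0 / 2 + m = m by omega, pow_add (-1) (2 * m) m, (even_two_mul m).neg_one_pow,
    Nat.cast_zero, Nat.cast_one] at h
  rw [h]
  ring

theorem chooseSumDiff_one {m : ℕ} (hm : 0 < m) :
    chooseSumDiff (2 * m + 1) (1 : R) = 2 ^ (2 * m + 1) * (4 * (m : R) + 1) + 2 := by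
  have h := chooseSumDiff_natCast (R := R) m 1
  rw [show 1 + (4 * m + 2) = (4 * m + 1) + 2 by ring, chooseSum_natCast_sub_add_two,
    chooseSum_natCast_sub_of_lt m (n := 4 * m + 1) (by omega),
    chooseSum_natCast_sub_of_lt m (n := 1 + (2 * m + 1)) (by omega),
    chooseSum_natCast_sub_of_lt m (n := 1) (by omega), Nat.choose_succ_self_right,
    show (4 * m + 1) / 2 + m = 2 * m + m by omega,
    show (1 + (2 * m + 1)) / 2 + m = 2 * m + 1 by omega,
    show 1 / 2 + m = m by omega, pow_add (-1) (2 * m) m, pow_add (-1) (2 * m) 1,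
    (even_two_mul m).neg_one_pow, Nat.cast_one] at h
  rw [h]
  push_cast
  ring

/-- Of the three shifted recurrences only the one at n + (2m+1) has a nonzero right-hand side. -/
theorem chooseSumDiff_add_two_add {m n : ℕ} (hn : n + 2 ≤ 2 * m) :
    chooseSumDiff (2 * m + 1) ((n : R) + 2) + chooseSumDiff (2 * m + 1) (n : R) =
      2 ^ (2 * m + 1) * ((n + 2 * (2 * m + 1)).choose (n + 2) : R) := by
  have h := chooseSumDiff_natCast (R := R) m (n + 2)
  have hc : (n + (4 * m + 2)).choose (4 * m) = (n + 2 * (2 * m + 1)).choose (n + 2) := by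
    rw [← Nat.choose_symm (by omega)]
    congr 1 <;> omega
  rw [show n + 2 + (4 * m + 2) = n + (4 * m + 2) + 2 by ring,
    show n + 2 + (2 * m + 1) = n + (2 * m + 1) + 2 by ring, chooseSum_natCast_sub_add_two,
    chooseSum_natCast_sub_add_two m (n + (2 * m + 1)), chooseSum_natCast_sub_add_two m n,
    Nat.choose_eq_zero_of_lt (n := n) (by omega),
    Nat.choose_eq_zero_of_lt (n := n + (2 * m + 1)) (by omega), hc] at h
  rw [show (n : R) + 2 = ((n + 2 : ℕ) : R) by push_cast; ring, h, chooseSumDiff_natCast]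
  push_cast
  ring

end Binomial

/-! ### Quadratic interpolation -/

theorem pow_three_dvd_quadratic_interpolation_error {R : Type*} [CommRing R] (P : R[X]) (a t : R) :
    a ^ 3 ∣ 2 * P.eval (a * t) - 2 * P.eval 0 - 2 * t * (P.eval 0 - P.eval (-a)) -
      t * (t + 1) * (P.eval a - 2 * P.eval 0 + P.eval (-a)) := by
  induction P using Polynomial.induction_on' with
  | add p q hp hq =>
    simp only [eval_add]
    convert dvd_add hp hq using 1
    ring
  | monomial n c =>
    simp only [eval_monomial]
    match n with
    | 0 => exact ⟨0, by ring⟩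
    | 1 => exact ⟨0, by ring⟩
    | 2 => exact ⟨0, by ring⟩
    | n + 3 =>
      refine ⟨c * (2 * a ^ n * t ^ (n + 3) + 2 * t * (-1) * (-a) ^ n -
        t * (t + 1) * (a ^ n - (-a) ^ n)), ?_⟩
      simp only [pow_add]
      ring

/-! ### Congruences in ℤ_p -/

section Padic

variable {p : ℕ} [Fact p.Prime]

theorem padicInt_dvd_iff_toZMod_eq_zero (a : ℤ_[p]) :
    (p : ℤ_[p]) ∣ a ↔ PadicInt.toZMod a = 0 := by
  rw [← RingHom.mem_ker, PadicInt.ker_toZMod, PadicInt.maximalIdeal_eq_span_p,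
    Ideal.mem_span_singleton]

theorem padicInt_dvd_sub_iff_toZMod_eq (a b : ℤ_[p]) :
    (p : ℤ_[p]) ∣ a - b ↔ PadicInt.toZMod a = PadicInt.toZMod b := by
  rw [padicInt_dvd_iff_toZMod_eq_zero, map_sub, sub_eq_zero]

theorem padicInt_isUnit_iff_not_dvd (a : ℤ_[p]) : IsUnit a ↔ ¬ (p : ℤ_[p]) ∣ a := by
  rw [← PadicInt.norm_lt_one_iff_dvd, ← PadicInt.not_isUnit_iff, not_not]

theorem padicInt_natCast_dvd_natCast (n : ℕ) : (p : ℤ_[p]) ∣ (n : ℤ_[p]) ↔ p ∣ n := by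
  rw [padicInt_dvd_iff_toZMod_eq_zero, map_natCast, ZMod.natCast_eq_zero_iff]

theorem padicInt_isUnit_natCast {n : ℕ} (hn : ¬ p ∣ n) : IsUnit (n : ℤ_[p]) := by
  rwa [padicInt_isUnit_iff_not_dvd, padicInt_natCast_dvd_natCast]

theorem padicInt_dvd_pow_sub_one_sub_one {a : ℤ_[p]} (ha : IsUnit a) :
    (p : ℤ_[p]) ∣ a ^ (p - 1) - 1 := by
  rw [padicInt_dvd_sub_iff_toZMod_eq, map_pow, map_one]
  exact ZMod.pow_card_sub_one_eq_one (ha.map PadicInt.toZMod).ne_zero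

theorem padicInt_dvd_pow_sub_self (a : ℤ_[p]) : (p : ℤ_[p]) ∣ a ^ p - a := by
  rw [padicInt_dvd_sub_iff_toZMod_eq, map_pow, ZMod.pow_card]

theorem padicInt_factorial_dvd_prime {m : ℕ} (hm : m < p) :
    (((p + m).factorial : ℕ) : ℤ_[p]) ∣ (p : ℤ_[p]) := by
  have hp : p.Prime := Fact.out
  induction m with
  | zero =>
    rw [add_zero, ← Nat.mul_factorial_pred hp.ne_zero, Nat.cast_mul]
    refine (padicInt_isUnit_natCast ?_).mul_right_dvd.mpr dvd_rfl
    rw [hp.dvd_factorial]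
    have := hp.pos
    omega
  | succ m ih =>
    rw [← add_assoc, Nat.factorial_succ, Nat.cast_mul]
    refine (padicInt_isUnit_natCast ?_).mul_left_dvd.mpr (ih (by omega))
    rw [add_assoc, Nat.dvd_add_right dvd_rfl]
    exact Nat.not_dvd_of_pos_of_lt (by omega) hm

theorem exists_polynomial_prime_mul_chooseSum :
    ∃ Q : ℤ_[p][X], ∀ y : ℤ_[p], (p : ℤ_[p]) * chooseSum p y = Q.eval y := by
  have hc : ∀ k : ℕ, ∃ c : ℤ_[p], k < p → (p : ℤ_[p]) = ((2 * k).factorial : ℕ) * c := by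
    intro k
    by_cases hk : k < p
    · obtain ⟨c, hc⟩ := (Nat.cast_dvd_cast (α := ℤ_[p])
        (Nat.factorial_dvd_factorial (show 2 * k ≤ p + k by omega))).trans
          (padicInt_factorial_dvd_prime hk)
      exact ⟨c, fun _ => hc⟩
    · exact ⟨0, fun h => absurd h hk⟩
  choose c hc using hc
  refine ⟨∑ k ∈ Finset.range p,
    C ((-2) ^ k * c k) * (descPochhammer ℤ_[p] (2 * k)).comp (X + C (k : ℤ_[p])), fun y => ?_⟩
  rw [chooseSum, Finset.mul_sum, eval_finsetSum]
  refine Finset.sum_congr rfl fun k hk => ?_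
  have h := Ring.descPochhammer_eq_factorial_smul_choose (y + (k : ℤ_[p])) (2 * k)
  rw [← aeval_eq_smeval, aeval_def, algebraMap_int_eq, nsmul_eq_mul] at h
  rw [← descPochhammer_map (Int.castRingHom ℤ_[p]), eval_mul, eval_C, eval_comp, eval_add, eval_X,
    eval_C, eval_map, h]
  linear_combination (-2) ^ k * Ring.choose (y + (k : ℤ_[p])) (2 * k) *
    hc k (Finset.mem_range.mp hk)

theorem prime_sq_dvd_chooseSum_interpolation_error (y t : ℤ_[p]) :
    (p : ℤ_[p]) ^ 2 ∣ 2 * chooseSum p (y + p * t) - 2 * chooseSum p y -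
      2 * t * (chooseSum p y - chooseSum p (y - p)) - t * (t + 1) * chooseSumDiff p y := by
  obtain ⟨Q, hQ⟩ := exists_polynomial_prime_mul_chooseSum (p := p)
  have hp : (p : ℤ_[p]) ≠ 0 := Nat.cast_ne_zero.mpr (Fact.out : p.Prime).ne_zero
  have h := pow_three_dvd_quadratic_interpolation_error (Q.comp (X + C y)) (p : ℤ_[p]) t
  simp only [eval_comp, eval_add, eval_X, eval_C, ← hQ] at h
  -- The error is divisible by p³ for pS, hence by p² for S.
  rw [← mul_dvd_mul_iff_left hp, ← pow_succ']
  convert h using 1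
  rw [chooseSumDiff, zero_add, neg_add_eq_sub, add_comm y, add_comm y]
  ring

theorem prime_dvd_choose_pred_sub {j : ℕ} (hj : j < p) :
    (p : ℤ_[p]) ∣ ((p - 1).choose j : ℤ_[p]) - (-1) ^ j := by
  induction j with
  | zero => simp
  | succ j ih =>
    have hp : p.Prime := Fact.out
    have h := (padicInt_natCast_dvd_natCast _).mpr (hp.dvd_choose_self j.succ_ne_zero hj)
    rw [Nat.choose_eq_choose_pred_add hp.pos j.succ_pos, Nat.succ_sub_one, Nat.cast_add] at h
    convert dvd_sub h (ih (by omega)) using 1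
    rw [pow_succ]
    ring

/-- (j+1) C(p,j+1) = p C(p-1,j) ≡ p(-1)^j, and (j+1)^(p-2) inverts j+1 modulo p. -/
theorem prime_sq_dvd_choose_add {j : ℕ} (hj : j + 1 < p) :
    (p : ℤ_[p]) ^ 2 ∣
      (p.choose (j + 1) : ℤ_[p]) + p * ((-1) ^ (j + 1) * ((j + 1 : ℕ) : ℤ_[p]) ^ (p - 2)) := by
  have hu : IsUnit ((j + 1 : ℕ) : ℤ_[p]) :=
    padicInt_isUnit_natCast (Nat.not_dvd_of_pos_of_lt j.succ_pos hj)
  rw [← hu.dvd_mul_left]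
  obtain ⟨r, hr⟩ := padicInt_dvd_pow_sub_one_sub_one hu
  obtain ⟨s, hs⟩ := prime_dvd_choose_pred_sub (p := p) (j := j) (by omega)
  have h := Nat.add_one_mul_choose_eq (p - 1) j
  rw [Nat.sub_add_cancel (by omega)] at h
  have h' := congrArg (Nat.cast (R := ℤ_[p])) h
  rw [Nat.cast_mul, Nat.cast_mul] at h'
  rw [show p - 1 = p - 2 + 1 by omega, pow_succ] at hr
  refine ⟨s - (-1) ^ j * r, ?_⟩
  linear_combination -h' + p * hs - p * (-1) ^ j * hr

theorem prime_sq_dvd_two_pow_sub_two_add_sum (hp : p ≠ 2) :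
    (p : ℤ_[p]) ^ 2 ∣ 2 ^ p - 2 +
      p * ∑ j ∈ Finset.range p, (-1) ^ j * (j : ℤ_[p]) ^ (p - 2) := by
  have hp' : p.Prime := Fact.out
  have h2 := hp'.two_le
  have h3 : p - 2 ≠ 0 := by omega
  obtain ⟨q, rfl⟩ : ∃ q, p = q + 1 := ⟨p - 1, by omega⟩
  have h := congrArg (Nat.cast (R := ℤ_[q + 1])) (Nat.sum_range_choose (q + 1))
  rw [Finset.sum_range_succ, Finset.sum_range_succ'] at h
  push_cast at h
  have key := Finset.dvd_sum fun j (hj : j ∈ Finset.range q) =>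
    prime_sq_dvd_choose_add (p := q + 1) (j := j) (by rw [Finset.mem_range] at hj; omega)
  rw [Finset.sum_add_distrib, ← Finset.mul_sum] at key
  rw [Finset.sum_range_succ', ← h]
  simp only [Nat.choose_zero_right, Nat.choose_self, Nat.cast_one, Nat.cast_zero, zero_pow h3,
    mul_zero, add_zero]
  convert key using 1
  ring

theorem prime_sq_dvd_two_pow_sub_two_add_eulerEval (hp : p ≠ 2) {h : ℤ_[p]} (hh : 2 * h = 1) :
    (p : ℤ_[p]) ^ 2 ∣ 2 ^ p - 2 + p * eulerEval h (p - 2) 0 := by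
  have hodd : Odd p := (Fact.out : p.Prime).odd_of_ne_two hp
  have h1 := sum_neg_one_pow_mul_pow hh (p - 2) p
  rw [hodd.neg_one_pow] at h1
  have h2 : (p : ℤ_[p]) ∣ eulerEval h (p - 2) p - eulerEval h (p - 2) 0 := by
    rw [padicInt_dvd_sub_iff_toZMod_eq, map_eulerEval, map_eulerEval]
    simp
  obtain ⟨r, hr⟩ := h2
  obtain ⟨s, hs⟩ := prime_sq_dvd_two_pow_sub_two_add_sum hp
  refine ⟨s - h * r, ?_⟩
  linear_combination hs - p * h * hr - p * h * h1 +
    p * (∑ j ∈ Finset.range p, (-1) ^ j * (j : ℤ_[p]) ^ (p - 2) - eulerEval h (p - 2) 0) * hh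

/-- The product equals 2p(2p-1) C(n+2p,n), and the last factor is 1 modulo p by Lucas. -/
theorem prime_sq_dvd_mul_choose_add (n : ℕ) (hn : n < p) :
    (p : ℤ_[p]) ^ 2 ∣ ((n + 1 : ℕ) : ℤ_[p]) * ((n + 2 : ℕ) : ℤ_[p]) *
      ((n + 2 * p).choose (n + 2) : ℤ_[p]) + 2 * p := by
  have hp : 0 < p := by omega
  have e1 := congrArg (Nat.cast (R := ℤ_[p])) (Nat.choose_succ_right_eq (n + 2 * p) (n + 1))
  have e2 := congrArg (Nat.cast (R := ℤ_[p])) (Nat.choose_succ_right_eq (n + 2 * p) n)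
  rw [show n + 2 * p - (n + 1) = 2 * p - 1 by omega] at e1
  rw [show n + 2 * p - n = 2 * p by omega] at e2
  rw [Nat.cast_mul, Nat.cast_mul, Nat.cast_sub (by omega), Nat.cast_mul, Nat.cast_one,
    Nat.cast_ofNat] at e1
  rw [Nat.cast_mul, Nat.cast_mul, Nat.cast_mul, Nat.cast_ofNat] at e2
  have hl : (p : ℤ_[p]) ∣ ((n + 2 * p).choose n : ℤ_[p]) - 1 := by
    have h := Choose.choose_modEq_choose_mod_mul_choose_div_nat (n := n + 2 * p) (k := n) (p := p)
    rw [Nat.add_mul_mod_self_right, Nat.mod_eq_of_lt hn, Nat.choose_self, Nat.div_eq_of_lt hn,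
      Nat.choose_zero_right, mul_one, ← ZMod.natCast_eq_natCast_iff] at h
    rw [padicInt_dvd_sub_iff_toZMod_eq, map_natCast, h]
    simp
  obtain ⟨r, hr⟩ := hl
  refine ⟨2 * (2 * ((n + 2 * p).choose n : ℤ_[p]) - r), ?_⟩
  linear_combination ((n + 1 : ℕ) : ℤ_[p]) * e1 + (2 * p - 1 : ℤ_[p]) * e2 - 2 * p * hr

/-- By Fermat the powers become 4/(n+1) - 4/(n+2) = 4/((n+1)(n+2)) modulo p, cancelling the binomial
term. -/
theorem prime_sq_dvd_recurrence_defect {h : ℤ_[p]} (hh : 2 * h = 1) {n : ℕ} (hn : n + 2 < p) :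
    (p : ℤ_[p]) ^ 2 ∣ 2 ^ p * ((n + 2 * p).choose (n + 2) : ℤ_[p]) +
      p * (2 * (((n : ℤ_[p]) + 1) * h) ^ (p - 2) + 2 * (-((n : ℤ_[p]) + 2) * h) ^ (p - 2)) := by
  have hu : IsUnit h := IsUnit.of_mul_eq_one_right 2 hh
  have h1 : IsUnit ((n + 1 : ℕ) : ℤ_[p]) :=
    padicInt_isUnit_natCast (Nat.not_dvd_of_pos_of_lt (by omega) (by omega))
  have h2 : IsUnit ((n + 2 : ℕ) : ℤ_[p]) :=
    padicInt_isUnit_natCast (Nat.not_dvd_of_pos_of_lt (by omega) hn)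
  obtain ⟨c, hc⟩ := prime_sq_dvd_mul_choose_add n (show n < p by omega)
  rw [← (h1.mul h2).dvd_mul_left]
  push_cast at h1 h2 hc ⊢
  obtain ⟨r, hr⟩ := padicInt_dvd_pow_sub_one_sub_one (h1.mul hu)
  obtain ⟨s, hs⟩ := padicInt_dvd_pow_sub_one_sub_one (h2.neg.mul hu)
  obtain ⟨w, hw⟩ := padicInt_dvd_pow_sub_self (2 : ℤ_[p])
  rw [show p - 1 = p - 2 + 1 by omega, pow_succ] at hr hs
  refine ⟨2 ^ p * c - 2 * w + 4 * (n + 2) * r - 4 * (n + 1) * s, ?_⟩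
  generalize (((n : ℤ_[p]) + 1) * h) ^ (p - 2) = A at *
  generalize (-((n : ℤ_[p]) + 2) * h) ^ (p - 2) = B at *
  linear_combination 2 ^ p * hc - 2 * p * hw + 4 * p * (n + 2) * hr - 4 * p * (n + 1) * hs -
    2 * p * (n + 1) * (n + 2) * (A + B) * hh

theorem prime_sq_dvd_chooseSumDiff_add_eulerPair (hp : p ≠ 2) {h : ℤ_[p]} (hh : 2 * h = 1)
    {n : ℕ} (hn : n < p) :
    (p : ℤ_[p]) ^ 2 ∣ chooseSumDiff p (n : ℤ_[p]) + p * eulerPair h (p - 2) (n : ℤ_[p]) := by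
  have hodd : Odd p := (Fact.out : p.Prime).odd_of_ne_two hp
  have h2 := (Fact.out : p.Prime).two_le
  have hodd' : Odd (p - 2) := Nat.Odd.sub_even (by omega) hodd even_two
  obtain ⟨m, hm⟩ := hodd
  have hE := prime_sq_dvd_two_pow_sub_two_add_eulerEval hp hh
  induction n using Nat.twoStepInduction with
  | zero =>
    have h0 := chooseSumDiff_zero (R := ℤ_[p]) m
    rw [← hm] at h0
    rwa [Nat.cast_zero, h0, eulerPair_zero h hodd']
  | one =>
    have h1 := chooseSumDiff_one (R := ℤ_[p]) (m := m) (by omega)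
    rw [← hm] at h1
    have hpm : (p : ℤ_[p]) = 2 * m + 1 := by exact_mod_cast hm
    rw [Nat.cast_one, h1, eulerPair_one hh hodd']
    obtain ⟨r, hr⟩ := padicInt_dvd_pow_sub_one_sub_one (IsUnit.of_mul_eq_one_right 2 hh)
    obtain ⟨w, hw⟩ := padicInt_dvd_pow_sub_self (2 : ℤ_[p])
    obtain ⟨e, he⟩ := hE
    rw [show p - 1 = p - 2 + 1 by omega, pow_succ] at hr
    refine ⟨-e + 2 * w - 4 * r, ?_⟩
    linear_combination -he + 2 * p * hw - 4 * p * hr + 2 * p * h ^ (p - 2) * hh - 2 * 2 ^ p * hpm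
  | more n ih _ =>
    have hD := chooseSumDiff_add_two_add (R := ℤ_[p]) (m := m) (n := n) (by omega)
    rw [← hm] at hD
    have hH := eulerPair_add_two_add hh (p - 2) (n : ℤ_[p])
    convert dvd_sub (prime_sq_dvd_recurrence_defect hh hn) (ih (by omega)) using 1
    push_cast
    linear_combination hD + p * hH

theorem prime_sq_dvd_chooseSum_sub (hp : p ≠ 2) {h : ℤ_[p]} (hh : 2 * h = 1) {n : ℕ} (hn : n < p)
    {x t : ℤ_[p]} (hx : x = n + p * t) :
    (p : ℤ_[p]) ^ 2 ∣ chooseSum p x -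
      ((-1) ^ ((n + 1) / 2) * (1 + t - (-1) ^ n * (-1) ^ (p / 2) * t) -
        p * t * (t + 1) * h * eulerPair h (p - 2) x) := by
  obtain ⟨m, hm⟩ := (Fact.out : p.Prime).odd_of_ne_two hp
  have s0 := chooseSum_natCast (R := ℤ_[p]) m (n := n) (by omega)
  have s1 := chooseSum_natCast_sub (R := ℤ_[p]) m (n := n) (by omega)
  rw [← hm] at s0 s1
  obtain ⟨a, ha⟩ := prime_sq_dvd_chooseSum_interpolation_error (p := p) (n : ℤ_[p]) t
  obtain ⟨b, hb⟩ := prime_sq_dvd_chooseSumDiff_add_eulerPair hp hh hn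
  -- The Euler term carries a factor p, so replacing n by x is needed only modulo p.
  have hH : (p : ℤ_[p]) ∣ eulerPair h (p - 2) x - eulerPair h (p - 2) n := by
    rw [padicInt_dvd_sub_iff_toZMod_eq, map_eulerPair, map_eulerPair, hx]
    simp
  obtain ⟨c, hc⟩ := hH
  rw [← hx, s0, s1] at ha
  rw [show p / 2 = m by omega]
  generalize chooseSum p x = S at *
  generalize eulerPair h (p - 2) x = H at *
  refine ⟨h * (a + t * (t + 1) * b + t * (t + 1) * c), ?_⟩
  linear_combination h * ha + h * t * (t + 1) * hb + h * t * (t + 1) * p * hc -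
    (S - (-1) ^ ((n + 1) / 2) * (1 + t - (-1) ^ n * (-1) ^ m * t)) * hh

theorem choose_mul_choose_add_eq (x : ℤ_[p]) (k : ℕ) :
    Ring.choose x k * Ring.choose (x + k) k =
      ((2 * k).choose k : ℤ_[p]) * Ring.choose (x + k) (2 * k) := by
  have h := Ring.choose_add_smul_choose x k k
  rw [← two_mul, nsmul_eq_mul] at h
  rw [h, mul_comm]

end Padic

theorem theorem1p2 (p : ℕ) [Fact p.Prime] (hp : Odd p) (x t : ℤ_[p])
    (hx : x = (x.zmodRepr : ℤ_[p]) + (p : ℤ_[p]) * t) :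
    PadicModEq p 2
      (∑ k ∈ Finset.range p,
        ((Ring.choose x k : ℤ_[p]) : ℚ_[p]) * ((Ring.choose (x + (k : ℤ_[p])) k : ℤ_[p]) : ℚ_[p])
          * (-2 : ℚ_[p]) ^ k / ((2 * k).choose k : ℚ_[p]))
      ((-1 : ℚ_[p]) ^ ((x.zmodRepr + 1) / 2)
          * (1 + (t : ℚ_[p])
              - (-1 : ℚ_[p]) ^ x.zmodRepr * ((legendreSym p (-1) : ℤ) : ℚ_[p]) * (t : ℚ_[p]))
        - (p : ℚ_[p]) * (t : ℚ_[p]) * ((t : ℚ_[p]) + 1) / 2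
          * (aeval (((x : ℚ_[p]) + 1) / 2) (eulerPolynomial (p - 2))
              + aeval (-(x : ℚ_[p]) / 2) (eulerPolynomial (p - 2)))) := by
  have hp2 : p ≠ 2 := by rintro rfl; exact absurd hp (by decide)
  have h2 : IsUnit (2 : ℤ_[p]) := by
    have h := padicInt_isUnit_natCast (p := p) (n := 2)
      (fun h => hp2 ((Nat.prime_dvd_prime_iff_eq Fact.out Nat.prime_two).mp h))
    simpa using h
  obtain ⟨h, hh⟩ := h2.exists_right_inv
  have hcoe : (h : ℚ_[p]) = 1 / 2 := by
    have := congrArg (fun z : ℤ_[p] => (z : ℚ_[p])) hh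
    simp only [PadicInt.coe_mul, PadicInt.coe_one] at this
    rw [eq_div_iff two_ne_zero, mul_comm]
    exact_mod_cast this
  have hleg : legendreSym p (-1) = (-1) ^ (p / 2) := by
    rw [legendreSym.at_neg_one hp2, ZMod.χ₄_eq_neg_one_pow (Nat.odd_iff.mp hp)]
  obtain ⟨z, hz⟩ := prime_sq_dvd_chooseSum_sub hp2 hh (PadicInt.zmodRepr_lt_p x) hx
  refine ⟨z, ?_⟩
  have hpair : aeval (((x : ℚ_[p]) + 1) / 2) (eulerPolynomial (p - 2)) +
      aeval (-(x : ℚ_[p]) / 2) (eulerPolynomial (p - 2)) =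
        ((eulerPair h (p - 2) x : ℤ_[p]) : ℚ_[p]) := by
    have hmap := map_eulerPair (PadicInt.Coe.ringHom (p := p)) h (p - 2) x
    change ((eulerPair h (p - 2) x : ℤ_[p]) : ℚ_[p]) = eulerPair (h : ℚ_[p]) (p - 2) (x : ℚ_[p])
      at hmap
    rw [hmap, hcoe, aeval_eulerPolynomial, aeval_eulerPolynomial, eulerPair, mul_one_div,
      mul_one_div]
  have hsum : ∑ k ∈ Finset.range p, ((Ring.choose x k : ℤ_[p]) : ℚ_[p]) *
      ((Ring.choose (x + (k : ℤ_[p])) k : ℤ_[p]) : ℚ_[p]) * (-2 : ℚ_[p]) ^ k /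
        ((2 * k).choose k : ℚ_[p]) = ((chooseSum p x : ℤ_[p]) : ℚ_[p]) := by
    rw [chooseSum, PadicInt.coe_sum]
    refine Finset.sum_congr rfl fun k _ => ?_
    have hne : ((2 * k).choose k : ℚ_[p]) ≠ 0 :=
      Nat.cast_ne_zero.mpr (Nat.choose_pos (by omega)).ne'
    rw [← PadicInt.coe_mul, choose_mul_choose_add_eq]
    have htwo : ((2 : ℤ_[p]) : ℚ_[p]) = 2 := rfl
    push_cast
    rw [htwo]
    field_simp
  rw [hpair, hsum, hleg]
  have hz' := congrArg (fun z : ℤ_[p] => (z : ℚ_[p])) hz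
  push_cast at hz' ⊢
  rw [hcoe] at hz'
  rw [← hz']
  ring
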